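/- Let $\rho_1,\dots,\rho_n$ be density matrices on $\mathbb{C}^d$ (positive semidefinite $d\times d$ complex matrices of trace one), all of full rank, and let $p=(p_1,\dots,p_n)$ be a probability vector. Write $\mathrm{F}(\rho,\sigma)=\operatorname{Tr}\sqrt{\sigma^{1/2}\rho\,\sigma^{1/2}}$ for the fidelity, where $P^{1/2}=\sqrt P$ is the positive semidefinite square root, let $f(\sigma)=\sum_{i=1}^n p_i\,\mathrm{F}(\rho_i,\sigma)$ be the average fidelity, and put $\Gamma(A)=A/\operatorname{Tr}A$. A density matrix $\sigma_\sharp$ is called an optimal state if it maximizes $f$ over all density matrices on $\mathbb{C}^d$. Then an optimal state exists, and every optimal state $\sigma_\sharp$ has the following properties. (a) There are unitary $d\times d$ matrices $U_1,\dots,U_n$ with $\sigma_\sharp^{1/2}\rho_i^{1/2}U_i=\sqrt{\sigma_\sharp^{1/2}\rho_i\,\sigma_\sharp^{1/2}}$ for every $i$, such that $$\sigma_\sharp=\frac1{f(\sigma_\sharp)}\sum_{i=1}^n p_i\,\rho_i^{1/2}U_i\,\sigma_\sharp^{1/2}=\frac1{f(\sigma_\sharp)}\sum_{i=1}^n p_i\,\sigma_\sharp^{1/2}\rho_i^{1/2}U_i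 .$$ (b) $$\sigma_\sharp=\Gamma\Big(\sum_{i=1}^n p_i\sqrt{\sigma_\sharp^{1/2}\rho_i\,\sigma_\sharp^{1/2}}\Big).$$ -/

import Mathlib

open scoped ComplexOrder MatrixOrder

noncomputable section

namespace AvgFidelity

variable {d n : ℕ}

/-- A density matrix (quantum state) on `ℂ^d`: positive semidefinite of trace one. -/
def IsState (ρ : Matrix (Fin d) (Fin d) ℂ) : Prop :=
  ρ.PosSemidef ∧ ρ.trace = 1

/-- The (square root) fidelity `F(ρ, σ) = Tr √(σ^{1/2} ρ σ^{1/2})`. For positive semidefinite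
arguments the trace is a nonnegative real number. -/
def fidelity (ρ σ : Matrix (Fin d) (Fin d) ℂ) : ℝ :=
  (CFC.sqrt (CFC.sqrt σ * ρ * CFC.sqrt σ)).trace.re

/-- The average fidelity `f(σ) = ∑ i, p i * F(ρ i, σ)` of `σ` over the ensemble `(ρ, p)`. -/
def avgFidelity (ρ : Fin n → Matrix (Fin d) (Fin d) ℂ) (p : Fin n → ℝ)
    (σ : Matrix (Fin d) (Fin d) ℂ) : ℝ :=
  ∑ i, p i * fidelity (ρ i) σ

/-- `σ` is an optimal state: it maximizes the average fidelity over all states. -/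
def IsOptimalState (ρ : Fin n → Matrix (Fin d) (Fin d) ℂ) (p : Fin n → ℝ)
    (σ : Matrix (Fin d) (Fin d) ℂ) : Prop :=
  IsState σ ∧ ∀ τ : Matrix (Fin d) (Fin d) ℂ, IsState τ → avgFidelity ρ p τ ≤ avgFidelity ρ p σ

/-- The normalization map `Γ(A) = A / Tr A`. -/
def normalize (A : Matrix (Fin d) (Fin d) ℂ) : Matrix (Fin d) (Fin d) ℂ :=
  (A.trace)⁻¹ • A

end AvgFidelity

end

/-! Let `σ` be optimal, `c` its average fidelity, `U i` the polar unitaries at `σ`, and `M = ∑ i, p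
i • (ρ i)^{1/2} U i`. In the Hilbert–Schmidt inner product `⟨σ^{1/2}, M⟩ = c` and `‖σ^{1/2}‖ = 1`,
so `c ≤ ‖M‖`. Conversely, `re_trace_le_fidelity` with `B = M / ‖M‖` gives `‖M‖ ≤ f(B Bᴴ) ≤ c` by
optimality. Equality in Cauchy–Schwarz forces `M = c σ^{1/2}`; multiplying by `σ^{1/2}` on either
side gives (a), and normalizing the trace gives (b). Existence is compactness plus continuity. -/

namespace AvgFidelity

variable {d n : ℕ}

/-- Two operators with the same absolute value differ by a unitary on the left. -/
theorem exists_unitary_mul_eq_of_star_mul_self_eq {H : Type*} [NormedAddCommGroup H]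
    [InnerProductSpace ℂ H] [FiniteDimensional ℂ H] [CompleteSpace H] (S T : H →L[ℂ] H)
    (h : star S * S = star T * T) : ∃ U ∈ unitary (H →L[ℂ] H), U * S = T := by
  have hnorm : ∀ x, ‖S x‖ = ‖T x‖ := by
    intro x
    have key : inner ℂ (S x) (S x) = inner ℂ (T x) (T x) := by
      rw [← ContinuousLinearMap.adjoint_inner_left, ← ContinuousLinearMap.adjoint_inner_left]
      have := congrArg (fun R : H →L[ℂ] H => inner ℂ (R x) x) h
      simpa [ContinuousLinearMap.star_eq_adjoint] using this
    rw [inner_self_eq_norm_sq_to_K, inner_self_eq_norm_sq_to_K] at key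
    have key' : ‖S x‖ ^ 2 = ‖T x‖ ^ 2 := by exact_mod_cast key
    exact (sq_eq_sq₀ (norm_nonneg _) (norm_nonneg _)).1 key'
  -- With `r` a linear section of `S`, the map `T ∘ r` is isometric on the range of `S`; in finite
  -- dimension it extends to a unitary.
  obtain ⟨r, hr⟩ := LinearMap.exists_rightInverse_of_surjective (S : H →ₗ[ℂ] H).rangeRestrict
    (LinearMap.range_rangeRestrict _)
  have hSr : ∀ y, S (r y) = y := fun y => congrArg Subtype.val (LinearMap.congr_fun hr y)
  let L : LinearMap.range (S : H →ₗ[ℂ] H) →ₗᵢ[ℂ] H :=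
    { toLinearMap := (T : H →ₗ[ℂ] H) ∘ₗ r
      norm_map' := fun y => by
        change ‖T (r y)‖ = ‖y‖
        rw [← hnorm, hSr]; rfl }
  let E : H ≃ₗᵢ[ℂ] H := L.extend.toLinearIsometryEquiv rfl
  refine ⟨Unitary.linearIsometryEquiv.symm E, (Unitary.linearIsometryEquiv.symm E).2, ?_⟩
  ext x
  have h1 : L.extend (S x) = T (r ⟨S x, x, rfl⟩) := L.extend_apply ⟨S x, x, rfl⟩
  have h2 : T (r ⟨S x, x, rfl⟩) = T x := by
    rw [← sub_eq_zero, ← map_sub, ← norm_eq_zero, ← hnorm, map_sub, hSr, sub_self, norm_zero]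
  exact h1.trans h2

/-- Right polar decomposition of a square matrix, singular or not. -/
theorem exists_unitary_mul_eq_sqrt (A : Matrix (Fin d) (Fin d) ℂ) :
    ∃ U ∈ Matrix.unitaryGroup (Fin d) ℂ, A * U = CFC.sqrt (A * A.conjTranspose) := by
  set S := CFC.sqrt (A * A.conjTranspose)
  have hAA : 0 ≤ A * A.conjTranspose := (Matrix.posSemidef_self_mul_conjTranspose A).nonneg
  have hSs : star S = S := (CFC.sqrt_nonneg _).isSelfAdjoint
  have hSS : S * S = A * A.conjTranspose := CFC.sqrt_mul_sqrt_self _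
  let Φ := Matrix.toEuclideanCLM (n := Fin d) (𝕜 := ℂ)
  obtain ⟨V, hV, hVS⟩ := exists_unitary_mul_eq_of_star_mul_self_eq (Φ S) (Φ (star A)) (by
    rw [← map_star, ← map_star, ← map_mul, ← map_mul, hSs, star_star, hSS]; rfl)
  have hW : Φ.symm V ∈ Matrix.unitaryGroup (Fin d) ℂ := by
    rw [Matrix.mem_unitaryGroup_iff']
    apply EquivLike.injective Φ
    rw [map_mul Φ, map_star Φ, StarAlgEquiv.apply_symm_apply, Unitary.star_mul_self_of_mem hV,
      map_one]
  have hWS : Φ.symm V * S = star A := by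
    apply EquivLike.injective Φ
    rw [map_mul Φ, ← hVS, StarAlgEquiv.apply_symm_apply]
  refine ⟨Φ.symm V, hW, ?_⟩
  have : A = S * star (Φ.symm V) := by
    rw [← star_star A, ← hWS, star_mul, hSs]
  rw [this, mul_assoc, Matrix.mem_unitaryGroup_iff'.1 hW, mul_one]

/-- A positive semidefinite `S` satisfies `Re Tr (S X) ≤ Re Tr S` for unitary `X`. -/
theorem re_trace_mul_unitary_le {S X : Matrix (Fin d) (Fin d) ℂ} (hS : S.PosSemidef)
    (hX : X ∈ Matrix.unitaryGroup (Fin d) ℂ) : (S * X).trace.re ≤ S.trace.re := by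
  -- Expanding this nonnegative trace gives `2 Tr S - 2 Re Tr (S X)`.
  have h := (hS.conjTranspose_mul_mul_same (1 - X)).trace_nonneg
  have e : ((1 - X).conjTranspose * S * (1 - X)).trace
      = 2 * S.trace - (S * X).trace - star (S * X).trace := by
    have hXX : X * X.conjTranspose = 1 := Matrix.mem_unitaryGroup_iff.1 hX
    have hstar : star (S * X).trace = (S * X.conjTranspose).trace := by
      rw [← Matrix.trace_conjTranspose, Matrix.conjTranspose_mul, hS.1.eq, Matrix.trace_mul_comm]
    have h2 : (S * ((1 - X) * (1 - X).conjTranspose)).trace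
        = 2 * S.trace - (S * X).trace - (S * X.conjTranspose).trace := by
      have : (1 - X) * (1 - X).conjTranspose = 1 + 1 - X - X.conjTranspose := by
        rw [Matrix.conjTranspose_sub, Matrix.conjTranspose_one, sub_mul, mul_sub, mul_sub, hXX]
        simp only [one_mul, mul_one]
        abel
      rw [this]
      simp only [mul_sub, mul_add, mul_one, Matrix.trace_sub, Matrix.trace_add]
      ring
    rw [hstar, ← h2, mul_assoc, Matrix.trace_mul_comm, mul_assoc]
  rw [e] at h
  have := (Complex.le_def.1 h).1
  simp at this
  linarith

/-! ### Square roots and Uhlmann's inequality -/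

theorem conjTranspose_sqrt (A : Matrix (Fin d) (Fin d) ℂ) :
    (CFC.sqrt A).conjTranspose = CFC.sqrt A :=
  (CFC.sqrt_nonneg A).isSelfAdjoint

theorem posSemidef_sqrt (A : Matrix (Fin d) (Fin d) ℂ) : (CFC.sqrt A).PosSemidef :=
  Matrix.nonneg_iff_posSemidef.1 (CFC.sqrt_nonneg A)

theorem sqrt_mul_sqrt_mul_conjTranspose {ρ : Matrix (Fin d) (Fin d) ℂ} (hρ : ρ.PosSemidef)
    (σ : Matrix (Fin d) (Fin d) ℂ) :
    (CFC.sqrt σ * CFC.sqrt ρ) * (CFC.sqrt σ * CFC.sqrt ρ).conjTranspose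
      = CFC.sqrt σ * ρ * CFC.sqrt σ := by
  have : CFC.sqrt ρ * CFC.sqrt ρ = ρ := CFC.sqrt_mul_sqrt_self _ hρ.nonneg
  rw [Matrix.conjTranspose_mul, conjTranspose_sqrt, conjTranspose_sqrt, mul_assoc,
    ← mul_assoc (CFC.sqrt ρ), this, mul_assoc]

theorem exists_unitary_sqrt_mul_sqrt_mul_eq {ρ : Matrix (Fin d) (Fin d) ℂ} (hρ : ρ.PosSemidef)
    (σ : Matrix (Fin d) (Fin d) ℂ) :
    ∃ U ∈ Matrix.unitaryGroup (Fin d) ℂ,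
      CFC.sqrt σ * CFC.sqrt ρ * U = CFC.sqrt (CFC.sqrt σ * ρ * CFC.sqrt σ) := by
  rw [← sqrt_mul_sqrt_mul_conjTranspose hρ σ]
  exact exists_unitary_mul_eq_sqrt _

/-- Uhlmann's inequality: every factorization `B Bᴴ` and unitary `U` bound the fidelity below. -/
theorem re_trace_le_fidelity {ρ : Matrix (Fin d) (Fin d) ℂ} (hρ : ρ.PosSemidef)
    (B : Matrix (Fin d) (Fin d) ℂ) {U : Matrix (Fin d) (Fin d) ℂ}
    (hU : U ∈ Matrix.unitaryGroup (Fin d) ℂ) :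
    (B.conjTranspose * (CFC.sqrt ρ * U)).trace.re ≤ fidelity ρ (B * B.conjTranspose) := by
  obtain ⟨W, hW, hBW⟩ := exists_unitary_mul_eq_sqrt B
  obtain ⟨V, hV, hAV⟩ := exists_unitary_sqrt_mul_sqrt_mul_eq hρ (B * B.conjTranspose)
  set T := CFC.sqrt (B * B.conjTranspose)
  have hB : B.conjTranspose = W * T := by
    have hTT : T.conjTranspose = T := conjTranspose_sqrt _
    rw [← hTT, ← hBW, Matrix.conjTranspose_mul, ← mul_assoc,
      show W * W.conjTranspose = 1 from Matrix.mem_unitaryGroup_iff.1 hW, one_mul]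
  have hA : T * CFC.sqrt ρ = CFC.sqrt (T * ρ * T) * star V := by
    rw [← hAV, mul_assoc, Matrix.mem_unitaryGroup_iff.1 hV, mul_one]
  -- Cyclicity of the trace gathers all three unitaries into one factor.
  have e : (B.conjTranspose * (CFC.sqrt ρ * U)).trace
      = (CFC.sqrt (T * ρ * T) * (star V * (U * W))).trace := by
    rw [hB, mul_assoc, Matrix.trace_mul_comm, ← mul_assoc T, hA]
    simp only [mul_assoc]
  rw [e]
  exact re_trace_mul_unitary_le (posSemidef_sqrt _)
    (mul_mem (Unitary.star_mem hV) (mul_mem hU hW))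

theorem fidelity_nonneg (ρ σ : Matrix (Fin d) (Fin d) ℂ) : 0 ≤ fidelity ρ σ :=
  (Complex.le_def.1 (posSemidef_sqrt _).trace_nonneg).1

theorem fidelity_self {ρ : Matrix (Fin d) (Fin d) ℂ} (hρ : IsState ρ) : fidelity ρ ρ = 1 := by
  have h0 : 0 ≤ ρ := hρ.1.nonneg
  have h1 : CFC.sqrt ρ * ρ * CFC.sqrt ρ = ρ * ρ := by
    have h := CFC.sqrt_mul_sqrt_self ρ h0
    calc CFC.sqrt ρ * ρ * CFC.sqrt ρ
        = CFC.sqrt ρ * (CFC.sqrt ρ * CFC.sqrt ρ) * CFC.sqrt ρ := by rw [h]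
      _ = (CFC.sqrt ρ * CFC.sqrt ρ) * (CFC.sqrt ρ * CFC.sqrt ρ) := by simp only [mul_assoc]
      _ = ρ * ρ := by rw [h]
  rw [fidelity, h1, CFC.sqrt_mul_self ρ h0, hρ.2, Complex.one_re]

/-- Some `ρ j` has positive weight and is itself a competitor, with average fidelity at least `p j`.
-/
theorem IsOptimalState.avgFidelity_pos {ρ : Fin n → Matrix (Fin d) (Fin d) ℂ} {p : Fin n → ℝ}
    (hp : p ∈ stdSimplex ℝ (Fin n)) (hρ : ∀ i, IsState (ρ i)) {σ : Matrix (Fin d) (Fin d) ℂ}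
    (hσ : IsOptimalState ρ p σ) : 0 < avgFidelity ρ p σ := by
  obtain ⟨j, hj⟩ : ∃ j, 0 < p j := by
    by_contra! h
    have : ∑ i, p i ≤ 0 := Finset.sum_nonpos fun i _ => h i
    linarith [hp.2]
  calc 0 < p j * fidelity (ρ j) (ρ j) := by rw [fidelity_self (hρ j), mul_one]; exact hj
    _ ≤ avgFidelity ρ p (ρ j) := Finset.single_le_sum
        (fun i _ => mul_nonneg (hp.1 i) (fidelity_nonneg (ρ i) (ρ j))) (Finset.mem_univ j)
    _ ≤ avgFidelity ρ p σ := hσ.2 _ (hρ j)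

theorem trace_conjTranspose_mul_self (M : Matrix (Fin d) (Fin d) ℂ) :
    (M.conjTranspose * M).trace = ((M.conjTranspose * M).trace.re : ℂ) := by
  have := (Complex.le_def.1 (Matrix.posSemidef_conjTranspose_mul_self M).trace_nonneg).2
  exact Complex.ext rfl (by simpa using this.symm)

/-! ### Existence by compactness -/

/-- States are the image of the Hilbert–Schmidt unit sphere under `B ↦ B Bᴴ`; the square root
supplies preimages. -/
theorem isCompact_setOf_isState : IsCompact {σ : Matrix (Fin d) (Fin d) ℂ | IsState σ} := by
  have hK : IsCompact {B : Matrix (Fin d) (Fin d) ℂ | (B * B.conjTranspose).trace = 1} := by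
    refine IsCompact.of_isClosed_subset (s := (Set.univ.pi fun _ => Set.univ.pi fun _ =>
      Metric.closedBall (0 : ℂ) 1 : Set (Fin d → Fin d → ℂ)))
      (isCompact_univ_pi fun _ => isCompact_univ_pi fun _ => isCompact_closedBall 0 1) ?_ ?_
    · exact isClosed_eq (by fun_prop) continuous_const
    · intro (B : Matrix (Fin d) (Fin d) ℂ) hB i _ j _
      have h : ∑ i, ∑ j, ‖B i j‖ ^ 2 = 1 := by
        have h' : (B * B.conjTranspose).trace = 1 := hB
        simp only [Matrix.trace, Matrix.diag, Matrix.mul_apply, Matrix.conjTranspose_apply,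
          Complex.star_def, Complex.mul_conj'] at h'
        exact_mod_cast h'
      have h1 : ‖B i j‖ ^ 2 ≤ ∑ j, ‖B i j‖ ^ 2 :=
        Finset.single_le_sum (f := fun j => ‖B i j‖ ^ 2) (fun _ _ => by positivity)
          (Finset.mem_univ j)
      have h2 : ∑ j, ‖B i j‖ ^ 2 ≤ 1 := h ▸
        Finset.single_le_sum (f := fun i => ∑ j, ‖B i j‖ ^ 2) (fun _ _ => by positivity)
          (Finset.mem_univ i)
      rw [mem_closedBall_zero_iff]
      nlinarith [norm_nonneg (B i j)]
  have himg := hK.image (f := fun B => B * B.conjTranspose) (by fun_prop)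
  convert himg using 1
  ext σ
  constructor
  · intro hσ
    have h : CFC.sqrt σ * (CFC.sqrt σ).conjTranspose = σ := by
      rw [conjTranspose_sqrt]; exact CFC.sqrt_mul_sqrt_self σ hσ.1.nonneg
    exact ⟨CFC.sqrt σ, by rw [Set.mem_ofPred_eq, h]; exact hσ.2, h⟩
  · rintro ⟨B, hB, rfl⟩
    exact ⟨Matrix.posSemidef_self_mul_conjTranspose B, hB⟩

open scoped Matrix.Norms.L2Operator in
theorem continuousOn_sqrt :
    ContinuousOn (CFC.sqrt : Matrix (Fin d) (Fin d) ℂ → _) {A | A.PosSemidef} := by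
  simpa only [Matrix.nonneg_iff_posSemidef] using
    CFC.continuousOn_sqrt (A := Matrix (Fin d) (Fin d) ℂ)

theorem continuousOn_fidelity {ρ : Matrix (Fin d) (Fin d) ℂ} (hρ : ρ.PosSemidef) :
    ContinuousOn (fidelity ρ) {σ | IsState σ} := by
  have h1 : ContinuousOn (fun σ : Matrix (Fin d) (Fin d) ℂ => CFC.sqrt σ) {σ | IsState σ} :=
    continuousOn_sqrt.mono fun σ hσ => hσ.1
  have h2 : ContinuousOn (fun σ => CFC.sqrt (CFC.sqrt σ * ρ * CFC.sqrt σ)) {σ | IsState σ} :=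
    continuousOn_sqrt.comp ((h1.mul continuousOn_const).mul h1) fun σ _ => by
      have := hρ.mul_mul_conjTranspose_same (CFC.sqrt σ)
      rwa [conjTranspose_sqrt] at this
  have h3 : Continuous fun A : Matrix (Fin d) (Fin d) ℂ => A.trace.re :=
    Complex.continuous_re.comp (by fun_prop)
  exact h3.comp_continuousOn h2

theorem exists_isOptimalState {ρ : Fin n → Matrix (Fin d) (Fin d) ℂ} {p : Fin n → ℝ}
    (hp : p ∈ stdSimplex ℝ (Fin n)) (hρ : ∀ i, IsState (ρ i)) :
    ∃ σ, IsOptimalState ρ p σ := by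
  have hn : Nonempty (Fin n) := by
    by_contra h
    rw [not_nonempty_iff] at h
    simpa using hp.2
  obtain ⟨σ, hσ, hmax⟩ := isCompact_setOf_isState.exists_isMaxOn
    (f := avgFidelity ρ p) ⟨ρ hn.some, hρ _⟩
    (continuousOn_finsetSum _ fun i _ =>
      continuousOn_const.mul (continuousOn_fidelity (hρ i).1))
  exact ⟨σ, hσ, fun τ hτ => hmax hτ⟩

/-! ### Optimality and the equality case -/

theorem isState_smul_mul_conjTranspose {M : Matrix (Fin d) (Fin d) ℂ}
    (hM : 0 < (M.conjTranspose * M).trace.re) :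
    IsState ((((√(M.conjTranspose * M).trace.re)⁻¹ : ℝ) • M) *
      (((√(M.conjTranspose * M).trace.re)⁻¹ : ℝ) • M).conjTranspose) := by
  refine ⟨Matrix.posSemidef_self_mul_conjTranspose _, ?_⟩
  set t := (M.conjTranspose * M).trace.re with ht
  have h : (M * M.conjTranspose).trace = (t : ℂ) := by
    rw [Matrix.trace_mul_comm, trace_conjTranspose_mul_self]
  rw [Matrix.conjTranspose_smul, Matrix.smul_mul, Matrix.mul_smul, smul_smul, Matrix.trace_smul,
    h, star_trivial, ← mul_inv, Real.mul_self_sqrt hM.le, Complex.real_smul, ← Complex.ofReal_mul,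
    inv_mul_cancel₀ hM.ne', Complex.ofReal_one]

/-- At an optimal state the matrix `∑ i, p i • (ρ i)^{1/2} U i` is a multiple of `σ^{1/2}`. -/
theorem IsOptimalState.sum_smul_sqrt_mul_eq {ρ : Fin n → Matrix (Fin d) (Fin d) ℂ}
    {p : Fin n → ℝ} (hp : p ∈ stdSimplex ℝ (Fin n)) (hρ : ∀ i, IsState (ρ i))
    {σ : Matrix (Fin d) (Fin d) ℂ} (hσ : IsOptimalState ρ p σ)
    {U : Fin n → Matrix (Fin d) (Fin d) ℂ} (hU : ∀ i, U i ∈ Matrix.unitaryGroup (Fin d) ℂ)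
    (hUσ : ∀ i, CFC.sqrt σ * CFC.sqrt (ρ i) * U i = CFC.sqrt (CFC.sqrt σ * ρ i * CFC.sqrt σ)) :
    ∑ i, p i • (CFC.sqrt (ρ i) * U i) = avgFidelity ρ p σ • CFC.sqrt σ := by
  set M := ∑ i, p i • (CFC.sqrt (ρ i) * U i) with hM
  set c := avgFidelity ρ p σ with hc
  have hcpos : 0 < c := hσ.avgFidelity_pos hp hρ
  have hσσ : CFC.sqrt σ * CFC.sqrt σ = σ := CFC.sqrt_mul_sqrt_self σ hσ.1.1.nonneg
  have hσM : (CFC.sqrt σ * M).trace.re = c := by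
    rw [hM, Finset.mul_sum, Matrix.trace_sum, Complex.re_sum, hc, avgFidelity]
    refine Finset.sum_congr rfl fun i _ => ?_
    rw [Matrix.mul_smul, Matrix.trace_smul, Complex.smul_re, ← mul_assoc, hUσ, smul_eq_mul,
      fidelity]
  have hMσ : (M.conjTranspose * CFC.sqrt σ).trace.re = c := by
    rw [← hσM, ← conjTranspose_sqrt σ, ← Matrix.conjTranspose_mul, Matrix.trace_conjTranspose,
      conjTranspose_sqrt σ]
    simp
  -- Cauchy–Schwarz with its exact remainder: the sign gives `c ^ 2 ≤ t`, and vanishing of the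
  -- remainder gives the claim.
  have hexp : ((M - c • CFC.sqrt σ).conjTranspose * (M - c • CFC.sqrt σ)).trace.re
      = (M.conjTranspose * M).trace.re - c ^ 2 := by
    simp only [Matrix.conjTranspose_sub, Matrix.conjTranspose_smul, conjTranspose_sqrt, sub_mul,
      mul_sub, Matrix.smul_mul, Matrix.mul_smul, hσσ, Matrix.trace_sub, Matrix.trace_smul,
      Complex.sub_re, Complex.smul_re, hσM, hMσ, hσ.1.2, star_trivial, smul_eq_mul,
      Complex.one_re]
    ring
  set t := (M.conjTranspose * M).trace.re with ht
  have htc : c ^ 2 ≤ t := by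
    have := (Complex.le_def.1
      (Matrix.posSemidef_conjTranspose_mul_self (M - c • CFC.sqrt σ)).trace_nonneg).1
    rw [hexp, Complex.zero_re] at this
    linarith
  have htpos : 0 < t := lt_of_lt_of_le (by positivity) htc
  have hle : √t ≤ c := by
    have hopt := hσ.2 _ (isState_smul_mul_conjTranspose (M := M) htpos)
    refine le_trans ?_ hopt
    rw [← ht]
    set B := (√t)⁻¹ • M with hB
    calc √t = (B.conjTranspose * M).trace.re := by
          rw [hB, Matrix.conjTranspose_smul, Matrix.smul_mul, Matrix.trace_smul, Complex.smul_re,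
            ← ht, star_trivial, smul_eq_mul, eq_inv_mul_iff_mul_eq₀ (Real.sqrt_pos.2 htpos).ne',
            Real.mul_self_sqrt htpos.le]
      _ = ∑ i, p i * (B.conjTranspose * (CFC.sqrt (ρ i) * U i)).trace.re := by
          rw [hM, Finset.mul_sum, Matrix.trace_sum, Complex.re_sum]
          refine Finset.sum_congr rfl fun i _ => ?_
          rw [Matrix.mul_smul, Matrix.trace_smul, Complex.smul_re, smul_eq_mul]
      _ ≤ avgFidelity ρ p (B * B.conjTranspose) := Finset.sum_le_sum fun i _ =>
          mul_le_mul_of_nonneg_left (re_trace_le_fidelity (hρ i).1 B (hU i)) (hp.1 i)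
  have htle : t ≤ c ^ 2 := (Real.sqrt_le_left hcpos.le).1 hle
  rw [← sub_eq_zero, ← Matrix.trace_conjTranspose_mul_self_eq_zero_iff,
    trace_conjTranspose_mul_self, hexp, le_antisymm htle htc, sub_self, Complex.ofReal_zero]

end AvgFidelity

theorem mainTheorem2 (d n : ℕ) (ρ : Fin n → Matrix (Fin d) (Fin d) ℂ) (p : Fin n → ℝ)
    (hp : p ∈ stdSimplex ℝ (Fin n))
    (hρ : ∀ i, AvgFidelity.IsState (ρ i)) (hfull : ∀ i, (ρ i).rank = d) :
    (∃ σ, AvgFidelity.IsOptimalState ρ p σ) ∧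
    ∀ σ, AvgFidelity.IsOptimalState ρ p σ →
      (∃ U : Fin n → Matrix (Fin d) (Fin d) ℂ,
        (∀ i, U i ∈ Matrix.unitaryGroup (Fin d) ℂ) ∧
        (∀ i, CFC.sqrt σ * CFC.sqrt (ρ i) * U i =
          CFC.sqrt (CFC.sqrt σ * ρ i * CFC.sqrt σ)) ∧
        σ = (1 / AvgFidelity.avgFidelity ρ p σ) •
          ∑ i, p i • (CFC.sqrt (ρ i) * U i * CFC.sqrt σ) ∧
        σ = (1 / AvgFidelity.avgFidelity ρ p σ) •
          ∑ i, p i • (CFC.sqrt σ * CFC.sqrt (ρ i) * U i)) ∧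
      σ = AvgFidelity.normalize
        (∑ i, p i • CFC.sqrt (CFC.sqrt σ * ρ i * CFC.sqrt σ)) := by
  refine ⟨AvgFidelity.exists_isOptimalState hp hρ, fun σ hσ => ?_⟩
  choose U hU hUσ using fun i =>
    AvgFidelity.exists_unitary_sqrt_mul_sqrt_mul_eq (hρ i).1 σ
  have hM := hσ.sum_smul_sqrt_mul_eq hp hρ hU hUσ
  have hc := hσ.avgFidelity_pos hp hρ
  set c := AvgFidelity.avgFidelity ρ p σ
  have hσσ : CFC.sqrt σ * CFC.sqrt σ = σ := CFC.sqrt_mul_sqrt_self σ hσ.1.1.nonneg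
  have hR : ∑ i, p i • (CFC.sqrt (ρ i) * U i * CFC.sqrt σ) = c • σ := by
    simp only [← Matrix.smul_mul]
    rw [← Finset.sum_mul]
    simp only [Matrix.smul_mul]
    rw [hM, Matrix.smul_mul, hσσ]
  have hL : ∑ i, p i • (CFC.sqrt σ * CFC.sqrt (ρ i) * U i) = c • σ := by
    simp only [mul_assoc]
    simp_rw [← Matrix.mul_smul (CFC.sqrt σ)]
    rw [← Finset.mul_sum, hM, Matrix.mul_smul, hσσ]
  have hcancel : σ = (1 / c) • (c • σ) := by
    rw [smul_smul, one_div_mul_cancel hc.ne', one_smul]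
  refine ⟨⟨U, hU, hUσ, by rw [hR]; exact hcancel, by rw [hL]; exact hcancel⟩, ?_⟩
  simp only [← hUσ]
  rw [hL, AvgFidelity.normalize, Matrix.trace_smul, hσ.1.2, ← Complex.coe_smul c σ, smul_smul,
    Complex.real_smul, mul_one, inv_mul_cancel₀ (by exact_mod_cast hc.ne'), one_smul]
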